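/- Let $\mathcal M$ be a smooth (Hausdorff, second countable) $m$-dimensional manifold and let $\pi:T^*\mathcal M\to T\mathcal M$ be a Poisson operator, i.e. a fibrewise linear, fibre-preserving map such that $\{F,G\}_\pi=\langle dF,\pi\,dG\rangle$ defines a skew-symmetric bracket on $C^\infty(\mathcal M)$ satisfying the Jacobi identity. Let $\varphi_1,\dots,\varphi_k\in C^\infty(\mathcal M)$ and let $Z_1,\dots,Z_k$ be smooth vector fields on $\mathcal M$ with $Z_j(\varphi_i)=\delta_{ij}$ everywhere on $\mathcal M$. For $\nu\in\mathbb R^k$ let $\mathcal S_\nu=\{x:\varphi_i(x)=\nu_i,\ i=1,\dots,k\}$; its tangent space at $x$ is $T_x\mathcal S_\nu=\bigcap_i\ker d\varphi_i(x)$. Let $\mathcal Z=\mathrm{span}(Z_1,\dots,Z_k)$, a distribution transversal to all $\mathcal S_\nu$. A function $F\in C^\infty(\mathcal M)$ is called $\mathcal Z|_{\mathcal S_\nu}$-invariant if $dF_x(z)=0$ for all $x\in\mathcal S_\nu$ and $z\in\mathcal Z_x$, and $\pi$ is called $\mathcal Z|_{\mathcal S_\nu}$-invariant if $\{F,G\}_\pi$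 is $\mathcal Z|_{\mathcal S_\nu}$-invariant for all $\mathcal Z|_{\mathcal S_\nu}$-invariant $F,G\in C^\infty(\mathcal M)$. Assume that at least one of the following two invariance conditions holds: (A) $\pi$ is $\mathcal Z|_{\mathcal S_\nu}$-invariant for every $\nu\in\mathbb R^k$; (B) $\mathcal Z$ is involutive and there are smooth vector fields $W^{(i)}_j$ with $L_{Z_i}\pi=\sum_{j=1}^k W^{(i)}_j\wedge Z_j$ for $i=1,\dots,k$. Let $V_1,\dots,V_k$ be smooth vector fields and let $$\pi_D=\pi-\sum_{j=1}^k V_j\wedge Z_j,\qquad (V\wedge Z)\alpha=\alpha(Z)V-\alpha(V)Z .$$ Suppose that $\pi_D(\alpha)\in\bigcap_i\ker d\varphi_i(x)$ for every $x\in\mathcal M$ and every $\alpha\in T_x^*\mathcal M$, i.e. $\pi_D$ maps every covector at $x$ to a vector tangent to the level set $\mathcal S_\nu$ through $x$. Then: 1. $\pi_D$ is a Poisson operator on $\mathcal M$. 2. Each $\varphi_i$ is a Casimir function of $\pi_D$: $\{F,\varphi_i\}_{\pi_D}=0$ for all $F\in C^\infty(\mathcal M)$. 3. For every $\nu\in\mathbb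 R^k$ and every smooth embedding $\iota:N\to\mathcal M$ of a smooth manifold $N$ of dimension $m-k$ with image $\mathcal S_\nu$, there is exactly one Poisson operator $\pi_R$ on $N$ (the Marsden–Ratiu reduced operator) such that $\{f,g\}_{\pi_R}=\{F,G\}_\pi\circ\iota$ for all $f,g\in C^\infty(N)$ and all $\mathcal Z|_{\mathcal S_\nu}$-invariant $F,G\in C^\infty(\mathcal M)$ with $F\circ\iota=f$, $G\circ\iota=g$; and $\pi_D$ coincides with it on $\mathcal S_\nu$: $\pi_D(\alpha)=d\iota_y\bigl(\pi_R(\alpha\circ d\iota_y)\bigr)$ for all $y\in N$ and $\alpha\in T^*_{\iota(y)}\mathcal M$. -/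

import Mathlib

open Set
open scoped Manifold ContDiff

universe u v

noncomputable section

namespace DiracReduction

/-- Fibre-preserving, fibrewise linear operators `T*M → TM` on an `m`-dimensional manifold `M`.
Smoothness is part of `IsPoisson` below. -/
abbrev FiberOperator (m : ℕ) (M : Type*) [TopologicalSpace M]
    [ChartedSpace (EuclideanSpace ℝ (Fin m)) M] :=
  (x : M) → (TangentSpace (𝓡 m) x →L[ℝ] ℝ) →ₗ[ℝ] TangentSpace (𝓡 m) x

/-- (Not necessarily smooth) vector fields. -/
abbrev VField (m : ℕ) (M : Type*) [TopologicalSpace M]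
    [ChartedSpace (EuclideanSpace ℝ (Fin m)) M] :=
  (x : M) → TangentSpace (𝓡 m) x

variable {m k : ℕ} {M : Type*} [TopologicalSpace M]
  [ChartedSpace (EuclideanSpace ℝ (Fin m)) M]

/-- Smooth real-valued functions. -/
def IsSmooth (m : ℕ) {M : Type*} [TopologicalSpace M]
    [ChartedSpace (EuclideanSpace ℝ (Fin m)) M] (F : M → ℝ) : Prop :=
  ContMDiff (𝓡 m) 𝓘(ℝ, ℝ) ∞ F

/-- Smooth vector fields, as smooth sections of the tangent bundle. -/
def IsSmoothField [IsManifold (𝓡 m) ∞ M] (X : VField m M) : Prop :=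
  ContMDiff (𝓡 m) (𝓡 m).tangent ∞
    (fun x => (⟨x, X x⟩ : TangentBundle (𝓡 m) M))

/-- The differential `dF` of a function at a point, as a covector. -/
def diff (m : ℕ) {M : Type*} [TopologicalSpace M]
    [ChartedSpace (EuclideanSpace ℝ (Fin m)) M] (F : M → ℝ) (x : M) :
    TangentSpace (𝓡 m) x →L[ℝ] ℝ :=
  mvfderiv (𝓡 m) F x

/-- The derivative `X(F)` of a function along a vector field. -/
def lieDeriv (X : VField m M) (F : M → ℝ) : M → ℝ :=
  fun x => diff m F x (X x)

/-- The bracket `{F, G}_π = ⟨dF, π dG⟩`. -/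
def bracket (π : FiberOperator m M) (F G : M → ℝ) : M → ℝ :=
  fun x => diff m F x (π x (diff m G x))

/-- `π` is a Poisson operator: its bracket maps smooth functions to smooth functions, is
skew-symmetric and satisfies the Jacobi identity. -/
structure IsPoisson (π : FiberOperator m M) : Prop where
  smooth : ∀ F G : M → ℝ, IsSmooth m F → IsSmooth m G → IsSmooth m (bracket π F G)
  skew : ∀ F G : M → ℝ, IsSmooth m F → IsSmooth m G →
    ∀ x, bracket π F G x = - bracket π G F x
  jacobi : ∀ F G H : M → ℝ, IsSmooth m F → IsSmooth m G → IsSmooth m H →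
    ∀ x, bracket π F (bracket π G H) x + bracket π G (bracket π H F) x
      + bracket π H (bracket π F G) x = 0

/-- `C` is a Casimir function of `π`. -/
def IsCasimir (π : FiberOperator m M) (C : M → ℝ) : Prop :=
  ∀ F : M → ℝ, IsSmooth m F → ∀ x, bracket π F C x = 0

/-- The bivector `v ∧ z` as a map on covectors, `(v ∧ z) α = α(z) v - α(v) z`. -/
def wedge {x : M} (v z : TangentSpace (𝓡 m) x) :
    (TangentSpace (𝓡 m) x →L[ℝ] ℝ) →ₗ[ℝ] TangentSpace (𝓡 m) x where
  toFun α := α z • v - α v • z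
  map_add' α β := by
    simp only [add_apply, add_smul]
    abel
  map_smul' c α := by
    simp only [smul_apply, smul_eq_mul, mul_smul, RingHom.id_apply, smul_sub]

/-- The deformation `π_D = π - ∑ⱼ Vⱼ ∧ Zⱼ`. -/
def deformation (π : FiberOperator m M) (V Z : Fin k → VField m M) : FiberOperator m M :=
  fun x => π x - ∑ j, wedge (V j x) (Z j x)

/-- The level set `S_ν = {φ = ν}`. -/
def leaf (φ : Fin k → M → ℝ) (ν : Fin k → ℝ) : Set M := {x | ∀ i, φ i x = ν i}

/-- The tangent space at `x` of the level set of `φ` through `x`, i.e. the common kernel of the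
`dφᵢ` (used only for `φᵢ` with independent differentials). -/
def leafTangent (φ : Fin k → M → ℝ) (x : M) : Submodule ℝ (TangentSpace (𝓡 m) x) :=
  ⨅ i, LinearMap.ker (diff m (φ i) x : TangentSpace (𝓡 m) x →ₗ[ℝ] ℝ)

/-- The distribution spanned by the vector fields `Zⱼ`. -/
def distribution (Z : Fin k → VField m M) (x : M) : Submodule ℝ (TangentSpace (𝓡 m) x) :=
  Submodule.span ℝ (range fun j => Z j x)

/-- `F` is invariant on `S` with respect to the distribution spanned by the `Zⱼ`: every vector of
the distribution based at a point of `S` annihilates `F`. -/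
def IsInvariantOn (Z : Fin k → VField m M) (S : Set M) (F : M → ℝ) : Prop :=
  ∀ x ∈ S, ∀ z ∈ distribution Z x, diff m F x z = 0

/-- `π` is invariant on `S` with respect to the distribution spanned by the `Zⱼ`: the smooth
functions that are invariant on `S` are closed under the bracket. -/
def OperatorInvariantOn (π : FiberOperator m M) (Z : Fin k → VField m M) (S : Set M) : Prop :=
  ∀ F G : M → ℝ, IsSmooth m F → IsSmooth m G → IsInvariantOn Z S F → IsInvariantOn Z S G →
    IsInvariantOn Z S (bracket π F G)

/-- The distribution spanned by the `Zⱼ` is involutive. -/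
def IsInvolutive (Z : Fin k → VField m M) : Prop :=
  ∀ i j x, VectorField.mlieBracket (𝓡 m) (Z i) (Z j) x ∈ distribution Z x

/-- The Lie derivative `L_X π`, evaluated on differentials:
`⟨dF, (L_X π) dG⟩ = X{F, G} - {X F, G} - {F, X G}`. -/
def lieDerivOperator (X : VField m M) (π : FiberOperator m M) (F G : M → ℝ) : M → ℝ :=
  fun x => lieDeriv X (bracket π F G) x - bracket π (lieDeriv X F) G x
    - bracket π F (lieDeriv X G) x

/-- `L_{Zᵢ} π = ∑ⱼ Wⱼ⁽ⁱ⁾ ∧ Zⱼ` for all `i`, for some smooth vector fields `Wⱼ⁽ⁱ⁾`. -/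
def LieDerivInWedge [IsManifold (𝓡 m) ∞ M] (π : FiberOperator m M)
    (Z : Fin k → VField m M) : Prop :=
  ∃ W : Fin k → Fin k → VField m M, (∀ i j, IsSmoothField (W i j)) ∧
    ∀ i, ∀ F G : M → ℝ, IsSmooth m F → IsSmooth m G → ∀ x,
      lieDerivOperator (Z i) π F G x =
        diff m F x ((∑ j, wedge (W i j x) (Z j x)) (diff m G x))

/-- `πR` is the Marsden–Ratiu reduction of `π` to the submanifold `ι : N → M`: it is a Poisson
operator on `N` with `{f, g}_{πR} = {F, G}_π` on `N` for all smooth `f, g` on `N` and all smooth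
prolongations `F, G` of `f, g` to `M` that are invariant on the submanifold. -/
structure IsReduction {s : ℕ} {N : Type*} [TopologicalSpace N]
    [ChartedSpace (EuclideanSpace ℝ (Fin s)) N]
    (π : FiberOperator m M) (Z : Fin k → VField m M) (ι : N → M)
    (πR : FiberOperator s N) : Prop where
  poisson : IsPoisson πR
  bracket_eq : ∀ (f g : N → ℝ) (F G : M → ℝ), IsSmooth s f → IsSmooth s g →
    IsSmooth m F → IsSmooth m G → F ∘ ι = f → G ∘ ι = g →
    IsInvariantOn Z (range ι) F → IsInvariantOn Z (range ι) G →
    ∀ y, bracket πR f g y = bracket π F G (ι y)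

end DiracReduction

end

/-! The Jacobi identity for `π_D` is checked at one point `x`, modulo the ideal `I` generated by the
`φᵢ - νᵢ` with `ν = φ(x)`. Tangency and skewness make the `φᵢ` Casimirs, so every derivation `{F,
·}_D` preserves `I`, and iterated deformed brackets depend only on the classes of their arguments
modulo `I`. Each function may thus be replaced by one whose `Z`-derivatives lie in `I`. On such
functions the terms `Vⱼ ∧ Zⱼ` contribute only elements of `I`; if moreover their `π`-brackets have
zero `Z`-derivatives at `x`, the deformed Jacobi sum at `x` equals that of `π`
(`deformedBracket_jacobi_of_extension`).

The replacements are Taylor polynomials in `φᵢ - νᵢ`, globally defined, so no flows are needed.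
Under (A) first order suffices. Under (B) the defect of `Zᵢ` as a derivation of the bracket contains
`{ZᵢF, G}`, and `{·, G}` need not preserve `I`; it does map `I ^ 2` into `I`. Second order puts the
`Z`-derivatives in `I ^ 2`, because involutive fields dual to the `φᵢ` commute
(`lieDeriv_comm_of_isInvolutive`).

For the reduction, a dimension count identifies the tangent space of the leaf with the image of
`dι`. A skew operator with values there factors through restricted covectors, hence is related by
`ι` to an operator on `N`. Local extensions transfer the Poisson axioms to it. It is unique because
every covector on `N` is the differential of the restriction of an invariant function. -/

namespace DiracReduction

/-! ### Derivations and brackets modulo the ideal of a leaf -/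

section Algebraic

variable {R : Type*} [CommRing R] [Algebra ℝ R] {k : ℕ}

/-- The ideal generated by the functions `φᵢ - νᵢ`. -/
def leafIdeal (φ : Fin k → R) (ν : Fin k → ℝ) : Ideal R :=
  Ideal.span (range fun i => φ i - algebraMap ℝ R (ν i))

/-- The derivation `{f, ·}` of the deformed bracket. -/
def deformedBracket (br : R → Derivation ℝ R R) (V Z : Fin k → Derivation ℝ R R) (f : R) :
    Derivation ℝ R R :=
  br f - ∑ j, (V j f • Z j - Z j f • V j)

theorem deformedBracket_apply (br : R → Derivation ℝ R R) (V Z : Fin k → Derivation ℝ R R)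
    (f g : R) : deformedBracket br V Z f g =
      br f g - ∑ j, (V j f * Z j g - Z j f * V j g) := by
  have h : ∀ s : Finset (Fin k), (∑ j ∈ s, (V j f • Z j - Z j f • V j)) g =
      ∑ j ∈ s, (V j f * Z j g - Z j f * V j g) := fun s => by
    induction s using Finset.cons_induction with
    | empty => simp
    | cons a s ha ih => rw [Finset.sum_cons, Finset.sum_cons, Derivation.add_apply, ih]; simp
  rw [deformedBracket, Derivation.sub_apply, h]

theorem leafIdeal_gen_mem (φ : Fin k → R) (ν : Fin k → ℝ) (i : Fin k) :
    φ i - algebraMap ℝ R (ν i) ∈ leafIdeal φ ν :=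
  Ideal.subset_span ⟨i, rfl⟩

/-- A derivation annihilating all `φᵢ` preserves the ideal of a leaf. -/
theorem derivation_mem_leafIdeal {φ : Fin k → R} {ν : Fin k → ℝ} (d : Derivation ℝ R R)
    (hd : ∀ i, d (φ i) = 0) {f : R} (hf : f ∈ leafIdeal φ ν) : d f ∈ leafIdeal φ ν := by
  induction hf using Submodule.span_induction with
  | mem x hx =>
    obtain ⟨i, rfl⟩ := hx
    simp [hd]
  | zero => simp
  | add x y _ _ hx hy => rw [map_add]; exact add_mem hx hy
  | smul a x hx hdx =>
    rw [smul_eq_mul, Derivation.leibniz, smul_eq_mul, smul_eq_mul]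
    exact add_mem (Ideal.mul_mem_left _ _ hdx) (Ideal.mul_mem_right _ _ hx)

/-- A derivation maps the square of an ideal into the ideal. -/
theorem derivation_mem_of_mem_sq {I : Ideal R} (d : Derivation ℝ R R) {f : R} (hf : f ∈ I ^ 2) :
    d f ∈ I := by
  rw [pow_two] at hf
  induction hf using Submodule.mul_induction_on' with
  | mem_mul_mem a ha b hb =>
    rw [Derivation.leibniz, smul_eq_mul, smul_eq_mul]
    exact add_mem (Ideal.mul_mem_right _ _ ha) (Ideal.mul_mem_right _ _ hb)
  | add x _ y _ hx hy => rw [map_add]; exact add_mem hx hy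

variable {br : R → Derivation ℝ R R} (hskew : ∀ f g, br f g = -br g f)
  {V Z : Fin k → Derivation ℝ R R} {φ : Fin k → R}

include hskew in
theorem deformedBracket_skew (f g : R) :
    deformedBracket br V Z f g = -deformedBracket br V Z g f := by
  have h : ∑ j, (V j g * Z j f - Z j g * V j f) = -∑ j, (V j f * Z j g - Z j f * V j g) := by
    rw [← Finset.sum_neg_distrib]
    exact Finset.sum_congr rfl fun j _ => by ring
  rw [deformedBracket_apply, deformedBracket_apply, hskew f g, h]
  ring

include hskew in
/-- If every function is congruent, modulo the ideal of a leaf, to one that is invariant along `Z`,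
and the brackets of the latter are invariant at a point of the leaf, then the deformed bracket
satisfies the Jacobi identity at this point. -/
theorem deformedBracket_jacobi_of_extension
    (hjac : ∀ f g h, br f (br g h) + br g (br h f) + br h (br f g) = 0)
    (hcas : ∀ f i, deformedBracket br V Z f (φ i) = 0)
    {ν : Fin k → ℝ} (ev : R →ₐ[ℝ] ℝ) (hev : ∀ f ∈ leafIdeal φ ν, ev f = 0)
    (E : R → R) (hE : ∀ f, E f - f ∈ leafIdeal φ ν) (hZE : ∀ f j, Z j (E f) ∈ leafIdeal φ ν)
    (hbr : ∀ f g j, ev (Z j (br (E f) (E g))) = 0) (f g h : R) :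
    ev (deformedBracket br V Z f (deformedBracket br V Z g h)
      + deformedBracket br V Z g (deformedBracket br V Z h f)
      + deformedBracket br V Z h (deformedBracket br V Z f g)) = 0 := by
  set I := leafIdeal φ ν with hI
  -- The Casimir property makes the deformed bracket well defined modulo `I`, in the second slot
  -- and, by skewness, in the first.
  have hright : ∀ a b c : R, b - c ∈ I →
      deformedBracket br V Z a b - deformedBracket br V Z a c ∈ I := fun a b c hbc => by
    rw [← map_sub]
    exact derivation_mem_leafIdeal _ (hcas a) hbc
  have hleft : ∀ a b c : R, b - c ∈ I →
      deformedBracket br V Z b a - deformedBracket br V Z c a ∈ I := fun a b c hbc => by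
    rw [deformedBracket_skew hskew b, deformedBracket_skew hskew c, ← neg_sub', neg_mem_iff]
    exact hright a b c hbc
  -- The inner correction terms lie in `I` by `hZE`. In the outer bracket one product vanishes under
  -- `ev` by `hbr`, the other because `Z j (E a)` is in `I`; invariance of the inner bracket is
  -- needed only at the point.
  have key : ∀ a b c : R, ev (deformedBracket br V Z a (deformedBracket br V Z b c)) =
      ev (br (E a) (br (E b) (E c))) := fun a b c => by
    have h1 : br (E b) (E c) - deformedBracket br V Z b c ∈ I := by
      have e1 : br (E b) (E c) - deformedBracket br V Z (E b) (E c) ∈ I := by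
        rw [deformedBracket_apply, sub_sub_cancel]
        exact sum_mem fun j _ => sub_mem (Ideal.mul_mem_left _ _ (hZE c j))
          (Ideal.mul_mem_right _ _ (hZE b j))
      have := add_mem (add_mem e1 (hleft (E c) (E b) b (hE b))) (hright b (E c) c (hE c))
      simpa using this
    have h2 := add_mem (hright (E a) _ _ h1) (hleft (deformedBracket br V Z b c) (E a) a (hE a))
    have h3 := hev _ h2
    rw [sub_add_sub_cancel, map_sub, sub_eq_zero] at h3
    rw [← h3, deformedBracket_apply, map_sub, map_sum, Finset.sum_eq_zero, sub_zero]
    intro j _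
    rw [map_sub, map_mul, map_mul, hbr, hev _ (hZE a j)]
    simp
  rw [map_add, map_add, key, key, key, ← map_add, ← map_add, hjac, map_zero]

/-- The first-order correction `f - ∑ᵢ (φᵢ - νᵢ) Zᵢ(f)`. -/
def linearCorrection (Z : Fin k → Derivation ℝ R R) (φ : Fin k → R) (ν : Fin k → ℝ) (f : R) : R :=
  f - ∑ i, (φ i - algebraMap ℝ R (ν i)) * Z i f

theorem linearCorrection_sub_mem (Z : Fin k → Derivation ℝ R R) (φ : Fin k → R) (ν : Fin k → ℝ)
    (f : R) : linearCorrection Z φ ν f - f ∈ leafIdeal φ ν := by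
  rw [linearCorrection, sub_sub_cancel_left, neg_mem_iff]
  exact sum_mem fun i _ => Ideal.mul_mem_right _ _ (leafIdeal_gen_mem φ ν i)

variable (hZφ : ∀ i j, Z j (φ i) = if i = j then 1 else 0)

include hZφ in
theorem derivation_sum_gen_mul (ν : Fin k → ℝ) (a : Fin k → R) (j : Fin k) :
    Z j (∑ i, (φ i - algebraMap ℝ R (ν i)) * a i) =
      a j + ∑ i, (φ i - algebraMap ℝ R (ν i)) * Z j (a i) := by
  simp [Derivation.leibniz, hZφ, Finset.sum_add_distrib, add_comm]

-- The summand in which `Z j` differentiates `φ j` cancels `Z j f`, leaving only terms with a factor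
-- from the ideal.
include hZφ in
theorem derivation_linearCorrection (ν : Fin k → ℝ) (f : R) (j : Fin k) :
    Z j (linearCorrection Z φ ν f) =
      -∑ i, (φ i - algebraMap ℝ R (ν i)) * Z j (Z i f) := by
  rw [linearCorrection, map_sub, derivation_sum_gen_mul hZφ]
  ring

include hZφ in
theorem derivation_linearCorrection_mem (ν : Fin k → ℝ) (f : R) (j : Fin k) :
    Z j (linearCorrection Z φ ν f) ∈ leafIdeal φ ν := by
  rw [derivation_linearCorrection hZφ, neg_mem_iff]
  exact sum_mem fun i _ => Ideal.mul_mem_right _ _ (leafIdeal_gen_mem φ ν i)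

/-- The second-order correction of `f`, whose `Z`-derivatives vanish to second order along the leaf
when the `Zⱼ` commute. -/
noncomputable def quadraticCorrection (Z : Fin k → Derivation ℝ R R) (φ : Fin k → R)
    (ν : Fin k → ℝ) (f : R) : R :=
  linearCorrection Z φ ν f - ∑ i, (φ i - algebraMap ℝ R (ν i)) *
    ((2⁻¹ : ℝ) • Z i (linearCorrection Z φ ν f))

theorem quadraticCorrection_sub_mem (Z : Fin k → Derivation ℝ R R) (φ : Fin k → R)
    (ν : Fin k → ℝ) (f : R) : quadraticCorrection Z φ ν f - f ∈ leafIdeal φ ν := by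
  rw [quadraticCorrection, sub_right_comm]
  exact sub_mem (linearCorrection_sub_mem Z φ ν f)
    (sum_mem fun i _ => Ideal.mul_mem_right _ _ (leafIdeal_gen_mem φ ν i))

-- With `uᵢ = φᵢ - νᵢ`, the correction is `f - ∑ uᵢ Zᵢf + ½ ∑ uᵢ uₗ ZᵢZₗf`. By commutativity both
-- differentiations of `uᵢ uₗ` give the same sum, so the factor `½` cancels the linear terms and `½
-- ∑ uᵢ uₗ ZⱼZᵢZₗf` remains.
include hZφ in
theorem derivation_quadraticCorrection_mem (hcomm : ∀ i j f, Z i (Z j f) = Z j (Z i f))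
    (ν : Fin k → ℝ) (f : R) (j : Fin k) :
    Z j (quadraticCorrection Z φ ν f) ∈ leafIdeal φ ν ^ 2 := by
  have h2 : ∀ i l, (φ i - algebraMap ℝ R (ν i)) * ((2⁻¹ : ℝ) •
      ((φ l - algebraMap ℝ R (ν l)) * Z j (Z i (Z l f)))) ∈ leafIdeal φ ν ^ 2 := fun i l => by
    rw [pow_two, mul_smul_comm, ← mul_assoc, Algebra.smul_def]
    exact Ideal.mul_mem_left _ _ (Ideal.mul_mem_right _ _
      (Ideal.mul_mem_mul (leafIdeal_gen_mem φ ν i) (leafIdeal_gen_mem φ ν l)))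
  have h3 : Z j (quadraticCorrection Z φ ν f) = ∑ i, ∑ l, (φ i - algebraMap ℝ R (ν i)) *
      ((2⁻¹ : ℝ) • ((φ l - algebraMap ℝ R (ν l)) * Z j (Z i (Z l f)))) := by
    rw [quadraticCorrection, map_sub, derivation_sum_gen_mul hZφ]
    have h4 : ∀ i, (φ i - algebraMap ℝ R (ν i)) *
        Z j ((2⁻¹ : ℝ) • Z i (linearCorrection Z φ ν f)) =
        -((2⁻¹ : ℝ) • ((φ i - algebraMap ℝ R (ν i)) * Z j (Z i f))) -
        ∑ l, (φ i - algebraMap ℝ R (ν i)) *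
          ((2⁻¹ : ℝ) • ((φ l - algebraMap ℝ R (ν l)) * Z j (Z i (Z l f)))) := fun i => by
      rw [Derivation.map_smul, derivation_linearCorrection hZφ, map_neg,
        derivation_sum_gen_mul hZφ, ← Finset.mul_sum, ← Finset.smul_sum, hcomm i j f]
      simp only [smul_neg, smul_add, mul_neg, mul_add, mul_smul_comm]
      abel
    simp only [h4, Finset.sum_sub_distrib, Finset.sum_neg_distrib, ← Finset.smul_sum]
    rw [derivation_linearCorrection hZφ]
    have h5 : ∀ x : R, x = (2⁻¹ : ℝ) • x + (2⁻¹ : ℝ) • x := fun x => by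
      rw [← add_smul]; norm_num
    set S := ∑ i, (φ i - algebraMap ℝ R (ν i)) * Z j (Z i f)
    nth_rewrite 1 [h5 S]
    rw [smul_neg]
    abel
  rw [h3]
  exact sum_mem fun i _ => sum_mem fun l _ => h2 i l

include hskew hZφ in
/-- If the `Zⱼ` commute and act on the bracket by derivations up to terms in the ideal generated by
the `Z`-derivatives, then brackets of second-order corrections are invariant on the leaf. -/
theorem derivation_bracket_quadraticCorrection_mem
    (hcomm : ∀ i j f, Z i (Z j f) = Z j (Z i f)) (W : Fin k → Fin k → R → R)
    (hW : ∀ i f g, Z i (br f g) - br (Z i f) g - br f (Z i g) =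
      ∑ j, (Z j g * W i j f - W i j g * Z j f))
    (ν : Fin k → ℝ) (f g : R) (i : Fin k) :
    Z i (br (quadraticCorrection Z φ ν f) (quadraticCorrection Z φ ν g)) ∈ leafIdeal φ ν := by
  have hq := derivation_quadraticCorrection_mem hZφ hcomm ν
  have hle : leafIdeal φ ν ^ 2 ≤ leafIdeal φ ν := Ideal.pow_le_self two_ne_zero
  rw [← sub_add_cancel (Z i _) (br (Z i (quadraticCorrection Z φ ν f))
      (quadraticCorrection Z φ ν g)), ← sub_add_cancel (Z i _ - _)
      (br (quadraticCorrection Z φ ν f) (Z i (quadraticCorrection Z φ ν g))), hW]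
  -- The `W`-terms only need `Z`-derivatives in the ideal. The two brackets need them in its square,
  -- since `br f` is an arbitrary derivation here.
  refine add_mem (add_mem (sum_mem fun j _ => sub_mem (Ideal.mul_mem_right _ _ (hle (hq g j)))
    (Ideal.mul_mem_left _ _ (hle (hq f j)))) (derivation_mem_of_mem_sq _ (hq g i))) ?_
  rw [hskew, neg_mem_iff]
  exact derivation_mem_of_mem_sq _ (hq f i)

end Algebraic

open scoped Topology

/-! ### Differentials, local-to-global extension and commutators of fields -/

section Differential

variable {m : ℕ} {M : Type*} [TopologicalSpace M] [ChartedSpace (EuclideanSpace ℝ (Fin m)) M]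

theorem IsSmooth.mdifferentiableAt {F : M → ℝ} (hF : IsSmooth m F) (x : M) :
    MDifferentiableAt (𝓡 m) 𝓘(ℝ, ℝ) F x :=
  ContMDiff.mdifferentiableAt hF (by simp)

theorem diff_congr {F G : M → ℝ} {x : M} (h : F =ᶠ[𝓝 x] G) : diff m F x = diff m G x := by
  ext v
  exact DFunLike.congr_fun (h.mfderiv_eq (I := 𝓡 m) (I' := 𝓘(ℝ, ℝ))) v

theorem diff_const (c : ℝ) (x : M) : diff m (fun _ => c) x = 0 :=
  mvfderiv_const c

theorem diff_add {F G : M → ℝ} (hF : IsSmooth m F) (hG : IsSmooth m G) (x : M) :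
    diff m (F + G) x = diff m F x + diff m G x :=
  mvfderiv_add (hF.mdifferentiableAt x) (hG.mdifferentiableAt x)

theorem diff_mul {F G : M → ℝ} (hF : IsSmooth m F) (hG : IsSmooth m G) (x : M) :
    diff m (F * G) x = F x • diff m G x + G x • diff m F x :=
  mvfderiv_mul (hF.mdifferentiableAt x) (hG.mdifferentiableAt x)

theorem diff_smul (c : ℝ) {F : M → ℝ} (hF : IsSmooth m F) (x : M) :
    diff m (c • F) x = c • diff m F x := by
  have h := diff_mul (m := m) (M := M) (F := fun _ => c) contMDiff_const hF x
  rw [diff_const, smul_zero, add_zero] at h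
  exact h

theorem diff_comp {s : ℕ} {N : Type*} [TopologicalSpace N]
    [ChartedSpace (EuclideanSpace ℝ (Fin s)) N] {F : M → ℝ} (hF : IsSmooth m F) {ι : N → M}
    {y : N} (hι : MDifferentiableAt (𝓡 s) (𝓡 m) ι y) :
    diff s (F ∘ ι) y = (diff m F (ι y)).comp (mfderiv (𝓡 s) (𝓡 m) ι y) :=
  mvfderiv_comp y (hF.mdifferentiableAt _) hι

variable [IsManifold (𝓡 m) ∞ M]

theorem IsSmoothField.isSmooth_lieDeriv {X : VField m M} (hX : IsSmoothField X) {F : M → ℝ}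
    (hF : IsSmooth m F) : IsSmooth m (lieDeriv X F) :=
  ContMDiff.comp (contMDiff_snd_tangentBundle_modelSpace ℝ 𝓘(ℝ, ℝ))
    (ContMDiff.comp (ContMDiff.contMDiff_tangentMap (m := ∞) (n := ∞) hF le_rfl) hX)

/-- A function that is smooth near a point agrees near it with a globally smooth one. -/
theorem exists_isSmooth_eventuallyEq [T2Space M] {x : M} {U : Set M} (hU : IsOpen U) (hx : x ∈ U)
    {g : M → ℝ} (hg : ContMDiffOn (𝓡 m) 𝓘(ℝ, ℝ) ∞ g U) :
    ∃ F : M → ℝ, IsSmooth m F ∧ F =ᶠ[𝓝 x] g := by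
  obtain ⟨f, -, hf⟩ := (SmoothBumpFunction.nhds_basis_tsupport (I := 𝓡 m) x).mem_iff.1
    (hU.mem_nhds hx)
  refine ⟨fun z => f z • g z, ?_, ?_⟩
  · refine contMDiff_of_tsupport fun z hz => ?_
    have hzU : z ∈ U := hf (tsupport_smul_subset_left _ _ hz)
    exact f.contMDiffAt.smul ((hg z hzU).contMDiffAt (hU.mem_nhds hzU))
  · filter_upwards [f.eventuallyEq_one] with z hz
    simp [hz]

/-- Every covector is the differential of a smooth function. -/
theorem exists_isSmooth_diff_eq [T2Space M] (x : M) (α : TangentSpace (𝓡 m) x →L[ℝ] ℝ) :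
    ∃ F : M → ℝ, IsSmooth m F ∧ diff m F x = α := by
  obtain ⟨e, he⟩ := isInvertible_mfderiv_extChartAt (I := 𝓡 m) (mem_extChartAt_source x)
  -- The function sought is linear in the chart: `β` is `α` transported by the inverse of the
  -- differential of the chart.
  let β : EuclideanSpace ℝ (Fin m) →L[ℝ] ℝ := 
    α.comp (e.symm : TangentSpace (𝓡 m) (extChartAt (𝓡 m) x x) →L[ℝ] TangentSpace (𝓡 m) x)
  obtain ⟨F, hF, hFx⟩ := exists_isSmooth_eventuallyEq (g := fun z => β (extChartAt (𝓡 m) x z))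
    (chartAt (EuclideanSpace ℝ (Fin m)) x).open_source (mem_chart_source _ x)
    (β.contMDiff.comp_contMDiffOn contMDiffOn_extChartAt)
  refine ⟨F, hF, ?_⟩
  rw [diff_congr hFx]
  have h : diff m (β ∘ extChartAt (𝓡 m) x) x =
      (mvfderiv 𝓘(ℝ, EuclideanSpace ℝ (Fin m)) β (extChartAt (𝓡 m) x x)).comp
        (mfderiv (𝓡 m) 𝓘(ℝ, EuclideanSpace ℝ (Fin m)) (extChartAt (𝓡 m) x) x) :=
    mvfderiv_comp x β.differentiableAt.mdifferentiableAt
      (mdifferentiableAt_extChartAt (mem_chart_source _ x))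
  refine h.trans ?_
  ext v
  rw [← he]
  have h2 : mvfderiv 𝓘(ℝ, EuclideanSpace ℝ (Fin m)) β (extChartAt (𝓡 m) x x) = β := by
    simp [mvfderiv, mfderiv_eq_fderiv]
    rfl
  rw [h2]
  exact congrArg α (e.symm_apply_apply v)

/-- A smooth vector field as a derivation of the algebra of smooth functions. -/
noncomputable def IsSmoothField.toDerivation {X : VField m M} (hX : IsSmoothField X) :
    Derivation ℝ C^∞⟮𝓡 m, M; 𝓘(ℝ, ℝ), ℝ⟯ C^∞⟮𝓡 m, M; 𝓘(ℝ, ℝ), ℝ⟯ :=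
  Derivation.mk'
    { toFun := fun F => ⟨lieDeriv X F, hX.isSmooth_lieDeriv F.contMDiff⟩
      map_add' := fun F G => by
        ext x
        exact congrArg (· (X x)) (diff_add F.contMDiff G.contMDiff x)
      map_smul' := fun c F => by
        ext x
        exact congrArg (· (X x)) (diff_smul c F.contMDiff x) }
    fun F G => by
      ext x
      exact congrArg (· (X x)) (diff_mul F.contMDiff G.contMDiff x)

/-- The derivation `{F, ·}` of a Poisson operator. -/
noncomputable def IsPoisson.toDerivation {π : FiberOperator m M} (hπ : IsPoisson π)
    (F : C^∞⟮𝓡 m, M; 𝓘(ℝ, ℝ), ℝ⟯) :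
    Derivation ℝ C^∞⟮𝓡 m, M; 𝓘(ℝ, ℝ), ℝ⟯ C^∞⟮𝓡 m, M; 𝓘(ℝ, ℝ), ℝ⟯ :=
  Derivation.mk'
    { toFun := fun G => ⟨bracket π F G, hπ.smooth F G F.contMDiff G.contMDiff⟩
      map_add' := fun G H => by
        ext x
        have e := diff_add G.contMDiff H.contMDiff x
        change diff m F x (π x (diff m (G + H) x)) = _
        erw [e, map_add, map_add]
        rfl
      map_smul' := fun c G => by
        ext x
        have e := diff_smul c G.contMDiff x
        change diff m F x (π x (diff m (c • G) x)) = _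
        erw [e, map_smul, map_smul]
        rfl }
    fun G H => by
      ext x
      have e := diff_mul G.contMDiff H.contMDiff x
      change diff m F x (π x (diff m (G * H) x)) = _
      erw [e, map_add, map_smul, map_smul, map_add, map_smul,
        map_smul]
      rfl

/-- The commutator formula `[X, Y](F) = X(Y(F)) - Y(X(F))`, at points where `X ≠ 0`. -/
theorem lieDeriv_mlieBracket {X Y : VField m M} (hX : IsSmoothField X) (hY : IsSmoothField Y)
    {F : M → ℝ} (hF : IsSmooth m F) {x : M} (hx : X x ≠ 0) :
    diff m F x (VectorField.mlieBracket (𝓡 m) X Y x) =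
      lieDeriv X (lieDeriv Y F) x - lieDeriv Y (lieDeriv X F) x := by
  have hms : minSmoothness ℝ 2 ≤ (∞ : ℕ∞ω) := by
    rw [minSmoothness_of_isRCLikeNormedField]
    exact WithTop.coe_le_coe.2 le_top
  have hms' : minSmoothness ℝ 3 ≤ (∞ : ℕ∞ω) := by
    rw [minSmoothness_of_isRCLikeNormedField]
    exact WithTop.coe_le_coe.2 le_top
  have : IsManifold (𝓡 m) (minSmoothness ℝ 3) M := .of_le hms'
  have : IsManifold (𝓡 m) (((⊤ : ℕ∞) : ℕ∞ω) + 1) M := .of_le (n := ∞) le_rfl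
  have hXd : MDifferentiable (𝓡 m) (𝓡 m).tangent (fun x => (⟨x, X x⟩ : TangentBundle (𝓡 m) M)) :=
    ContMDiff.mdifferentiable hX (by simp)
  have hFX : IsSmoothField (fun z => F z • X z) := ContMDiff.smul_section hF hX
  have hYXs : IsSmoothField (VectorField.mlieBracket (𝓡 m) Y X) := fun z =>
    ContMDiffAt.mlieBracket_vectorField (m := ⊤) (n := ⊤) (hY z) (hX z) (by simp)
  have hYX : MDifferentiable (𝓡 m) (𝓡 m).tangent
      (fun x => (⟨x, VectorField.mlieBracket (𝓡 m) Y X x⟩ : TangentBundle (𝓡 m) M)) :=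
    ContMDiff.mdifferentiable hYXs (by simp)
  have smul_right : ∀ (A B : VField m M) (G : M → ℝ), IsSmooth m G → (∀ z, MDifferentiableAt (𝓡 m)
      (𝓡 m).tangent (fun x => (⟨x, B x⟩ : TangentBundle (𝓡 m) M)) z) →
      VectorField.mlieBracket (𝓡 m) A (G • B) =
        lieDeriv A G • B + G • VectorField.mlieBracket (𝓡 m) A B := fun A B G hG hB => by
    funext z
    exact VectorField.mlieBracket_smul_right (hG.mdifferentiableAt z) (hB z)
  -- The commutator formula is extracted from the Jacobi identity of fields: expand it for `X, Y, F
  -- • X` and subtract `F` times the one for `X, Y, X`. What remains is the formula multiplied by `X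
  -- x`, which `hx` cancels.
  have h1 := VectorField.leibniz_identity_mlieBracket_apply (U := X) (V := Y) (W := F • X) (x := x)
    ((hX x).of_le hms) ((hY x).of_le hms) ((hFX x).of_le hms)
  have h2 := VectorField.leibniz_identity_mlieBracket_apply (U := X) (V := Y) (W := X) (x := x)
    ((hX x).of_le hms) ((hY x).of_le hms) ((hX x).of_le hms)
  have hXF := hX.isSmooth_lieDeriv hF
  have hYF := hY.isSmooth_lieDeriv hF
  rw [VectorField.mlieBracket_self, VectorField.mlieBracket_zero_right, Pi.zero_apply, add_zero] at h2
  rw [smul_right Y X F hF hXd, smul_right X X F hF hXd, VectorField.mlieBracket_self, smul_zero,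
    add_zero, smul_right _ X F hF hXd, smul_right Y X _ hXF hXd,
    VectorField.mlieBracket_add_right, smul_right X X _ hYF hXd, smul_right X _ F hF hYX,
    VectorField.mlieBracket_self] at h1
  · simp only [Pi.add_apply, Pi.smul_apply', smul_zero, h2] at h1
    have h3 : diff m F x (VectorField.mlieBracket (𝓡 m) X Y x) • X x =
        (lieDeriv X (lieDeriv Y F) x - lieDeriv Y (lieDeriv X F) x) • X x := by
      rw [sub_smul, eq_sub_iff_add_eq]
      have h4 : lieDeriv (VectorField.mlieBracket (𝓡 m) X Y) F x • X x +
          lieDeriv Y (lieDeriv X F) x • X x = lieDeriv X (lieDeriv Y F) x • X x := by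
        generalize VectorField.mlieBracket (𝓡 m) (VectorField.mlieBracket (𝓡 m) X Y) X x = a at h1
        generalize VectorField.mlieBracket (𝓡 m) Y X x = b at h1
        rw [show (0 : VField m M) x = 0 from rfl] at h1
        have h5 := sub_eq_zero.2 h1
        rw [← sub_eq_zero, ← neg_eq_zero, ← h5]
        module
      exact h4
    exact smul_left_injective ℝ hx h3
  · exact (ContMDiff.mdifferentiable (ContMDiff.smul_section hYF hX) (by simp)) x
  · exact (ContMDiff.mdifferentiable (ContMDiff.smul_section hF hYXs) (by simp)) x

end Differential

/-! ### The deformed operator is Poisson -/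

section Deformation

variable {m k : ℕ} {M : Type*} [TopologicalSpace M] [ChartedSpace (EuclideanSpace ℝ (Fin m)) M]

theorem isInvariantOn_iff {Z : Fin k → VField m M} {S : Set M} {F : M → ℝ} :
    IsInvariantOn Z S F ↔ ∀ x ∈ S, ∀ j, lieDeriv (Z j) F x = 0 := by
  refine ⟨fun h x hx j => h x hx _ (Submodule.subset_span ⟨j, rfl⟩), fun h x hx z hz => ?_⟩
  have hle : distribution Z x ≤
      LinearMap.ker (diff m F x : TangentSpace (𝓡 m) x →ₗ[ℝ] ℝ) := by
    refine Submodule.span_le.2 ?_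
    rintro _ ⟨j, rfl⟩
    exact h x hx j
  exact hle hz

theorem apply_sum_wedge {x : M} (V Z : Fin k → VField m M)
    (α β : TangentSpace (𝓡 m) x →L[ℝ] ℝ) :
    α ((∑ j, wedge (V j x) (Z j x)) β) = ∑ j, (α (V j x) * β (Z j x) - α (Z j x) * β (V j x)) := by
  rw [LinearMap.sum_apply, map_sum]
  refine Finset.sum_congr rfl fun j _ => ?_
  change α (β (Z j x) • V j x - β (V j x) • Z j x) = _
  rw [map_sub, map_smul, map_smul, smul_eq_mul, smul_eq_mul]
  ring

theorem apply_deformation {x : M} (π : FiberOperator m M) (V Z : Fin k → VField m M)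
    (α β : TangentSpace (𝓡 m) x →L[ℝ] ℝ) :
    α (deformation π V Z x β) =
      α (π x β) - ∑ j, (α (V j x) * β (Z j x) - α (Z j x) * β (V j x)) := by
  rw [← apply_sum_wedge, ← map_sub]
  rfl

theorem bracket_deformation_skew {π : FiberOperator m M} (hπ : IsPoisson π)
    (V Z : Fin k → VField m M) {F G : M → ℝ} (hF : IsSmooth m F) (hG : IsSmooth m G) (x : M) :
    bracket (deformation π V Z) F G x = -bracket (deformation π V Z) G F x := by
  have h := hπ.skew F G hF hG x
  simp only [bracket, apply_deformation] at h ⊢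
  rw [h, neg_sub', ← Finset.sum_neg_distrib]
  congr 1
  exact Finset.sum_congr rfl fun j _ => by ring

/-- Tangency says that `dφᵢ` kills the image of `π_D`, which is the vanishing of `{φᵢ, F}`; skewness
exchanges the slots. -/
theorem isCasimir_deformation {π : FiberOperator m M} (hπ : IsPoisson π) {φ : Fin k → M → ℝ}
    (hφ : ∀ i, IsSmooth m (φ i)) {V Z : Fin k → VField m M}
    (htan : ∀ (x : M) (α : TangentSpace (𝓡 m) x →L[ℝ] ℝ),
      deformation π V Z x α ∈ leafTangent φ x) (i : Fin k) :
    IsCasimir (deformation π V Z) (φ i) := fun F hF x => by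
  rw [bracket_deformation_skew hπ V Z hF (hφ i), neg_eq_zero]
  exact (Submodule.mem_iInf _).1 (htan x _) i

variable [IsManifold (𝓡 m) ∞ M]

omit [IsManifold (𝓡 m) ∞ M] in
theorem eq_zero_of_mem_leafIdeal {φ : Fin k → C^∞⟮𝓡 m, M; 𝓘(ℝ, ℝ), ℝ⟯} {ν : Fin k → ℝ}
    {f : C^∞⟮𝓡 m, M; 𝓘(ℝ, ℝ), ℝ⟯} (hf : f ∈ leafIdeal φ ν) {x : M}
    (hx : x ∈ leaf (fun i => ⇑(φ i)) ν) : f x = 0 := by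
  induction hf using Submodule.span_induction with
  | mem f hf =>
    obtain ⟨i, rfl⟩ := hf
    exact sub_eq_zero.2 (hx i)
  | zero => rfl
  | add f g _ _ hf hg => exact (congrArg₂ (· + ·) hf hg).trans (add_zero 0)
  | smul a f _ hf => exact (congrArg (a x * ·) hf).trans (mul_zero _)

/-- Evaluation of smooth functions at a point. -/
noncomputable def evalAt (m : ℕ) {M : Type*} [TopologicalSpace M]
    [ChartedSpace (EuclideanSpace ℝ (Fin m)) M] (x : M) : C^∞⟮𝓡 m, M; 𝓘(ℝ, ℝ), ℝ⟯ →ₐ[ℝ] ℝ :=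
  (Pi.evalAlgHom ℝ (fun _ : M => ℝ) x).comp ContMDiffMap.coeFnAlgHom

omit [IsManifold (𝓡 m) ∞ M] in
theorem evalAt_apply (x : M) (f : C^∞⟮𝓡 m, M; 𝓘(ℝ, ℝ), ℝ⟯) : evalAt m x f = f x :=
  rfl

theorem coe_deformedBracket {π : FiberOperator m M} (hπ : IsPoisson π) {V Z : Fin k → VField m M}
    (hV : ∀ j, IsSmoothField (V j)) (hZ : ∀ j, IsSmoothField (Z j))
    (F G : C^∞⟮𝓡 m, M; 𝓘(ℝ, ℝ), ℝ⟯) :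
    ⇑(deformedBracket hπ.toDerivation (fun j => (hV j).toDerivation)
      (fun j => (hZ j).toDerivation) F G) = bracket (deformation π V Z) F G := by
  funext x
  rw [← evalAt_apply]
  rw [deformedBracket_apply, map_sub, map_sum, bracket, apply_deformation]
  rfl

/-- Vector fields dual to functions `φᵢ` that span an involutive distribution commute. -/
theorem lieDeriv_comm_of_isInvolutive {φ : Fin k → M → ℝ} (hφ : ∀ i, IsSmooth m (φ i))
    {Z : Fin k → VField m M} (hZ : ∀ j, IsSmoothField (Z j))
    (hZφ : ∀ i j x, lieDeriv (Z j) (φ i) x = if i = j then 1 else 0) (hinv : IsInvolutive Z)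
    {F : M → ℝ} (hF : IsSmooth m F) (i j : Fin k) (x : M) :
    lieDeriv (Z i) (lieDeriv (Z j) F) x = lieDeriv (Z j) (lieDeriv (Z i) F) x := by
  have hne : Z i x ≠ 0 := fun h => by
    have h1 := hZφ i i x
    rw [if_pos rfl, lieDeriv, h, map_zero] at h1
    exact zero_ne_one h1
  have hconst : ∀ a b l, lieDeriv (Z a) (lieDeriv (Z b) (φ l)) x = 0 := fun a b l => by
    rw [funext (hZφ l b), lieDeriv, diff_const]
    rfl
  obtain ⟨c, hc⟩ := (Submodule.mem_span_range_iff_exists_fun ℝ).1 (hinv i j x)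
  -- Applied to `φ l`, the combination gives `c l`, while the commutator gives zero because all
  -- `Z`-derivatives of `φ l` are constant.
  have hc0 : ∀ l, c l = 0 := fun l => by
    have h1 := lieDeriv_mlieBracket (hZ i) (hZ j) (hφ l) hne
    rw [hconst, hconst, sub_zero, ← hc, map_sum] at h1
    have h2 : ∀ a, diff m (φ l) x (c a • Z a x) = if l = a then c a else 0 := fun a => by
      rw [map_smul, smul_eq_mul]
      exact (congrArg (c a * ·) (hZφ l a x)).trans (by simp)
    simpa [h2] using h1
  have h0 : VectorField.mlieBracket (𝓡 m) (Z i) (Z j) x = 0 := by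
    rw [← hc]
    simp [hc0]
  have h1 := lieDeriv_mlieBracket (hZ i) (hZ j) hF hne
  rw [h0, map_zero] at h1
  exact (sub_eq_zero.1 h1.symm)

theorem toDerivation_apply_eq {φ : Fin k → C^∞⟮𝓡 m, M; 𝓘(ℝ, ℝ), ℝ⟯} {Z : Fin k → VField m M}
    (hZ : ∀ j, IsSmoothField (Z j))
    (hZφ : ∀ i j x, lieDeriv (Z j) (φ i) x = if i = j then 1 else 0) (i j : Fin k) :
    (hZ j).toDerivation (φ i) = if i = j then 1 else 0 := by
  ext x
  refine (hZφ i j x).trans ?_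
  split_ifs <;> rfl

/-- Brackets of linear corrections are invariant on a leaf on which the operator is. -/
theorem lieDeriv_bracket_linearCorrection {π : FiberOperator m M} (hπ : IsPoisson π)
    {φ : Fin k → C^∞⟮𝓡 m, M; 𝓘(ℝ, ℝ), ℝ⟯} {Z : Fin k → VField m M}
    (hZ : ∀ j, IsSmoothField (Z j))
    (hZφ : ∀ i j x, lieDeriv (Z j) (φ i) x = if i = j then 1 else 0) {ν : Fin k → ℝ}
    (hinv : OperatorInvariantOn π Z (leaf (fun i => ⇑(φ i)) ν)) {x : M}
    (hx : x ∈ leaf (fun i => ⇑(φ i)) ν) (f g : C^∞⟮𝓡 m, M; 𝓘(ℝ, ℝ), ℝ⟯) (j : Fin k) :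
    evalAt m x ((hZ j).toDerivation (hπ.toDerivation
      (linearCorrection (fun j => (hZ j).toDerivation) φ ν f)
      (linearCorrection (fun j => (hZ j).toDerivation) φ ν g))) = 0 := by
  have hE : ∀ f, IsInvariantOn Z (leaf (fun i => ⇑(φ i)) ν)
      ⇑(linearCorrection (fun j => (hZ j).toDerivation) φ ν f) := fun f =>
    isInvariantOn_iff.2 fun y hy l => by
      have h := derivation_linearCorrection_mem (Z := fun j => (hZ j).toDerivation)
        (toDerivation_apply_eq hZ hZφ) ν f l
      exact eq_zero_of_mem_leafIdeal h hy
  have h := isInvariantOn_iff.1 (hinv _ _ (ContMDiffMap.contMDiff _) (ContMDiffMap.contMDiff _)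
    (hE f) (hE g)) x hx j
  exact h

/-- Brackets of quadratic corrections are invariant on the leaves if `L_{Zᵢ} π` lies in the ideal
generated by the commuting fields `Zⱼ`. -/
theorem lieDeriv_bracket_quadraticCorrection {π : FiberOperator m M} (hπ : IsPoisson π)
    {φ : Fin k → C^∞⟮𝓡 m, M; 𝓘(ℝ, ℝ), ℝ⟯} {Z : Fin k → VField m M}
    (hZ : ∀ j, IsSmoothField (Z j))
    (hZφ : ∀ i j x, lieDeriv (Z j) (φ i) x = if i = j then 1 else 0) {ν : Fin k → ℝ}
    (hcomm : ∀ i j f, (hZ i).toDerivation ((hZ j).toDerivation f) =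
      (hZ j).toDerivation ((hZ i).toDerivation f))
    (hinv : LieDerivInWedge π Z) {x : M}
    (hx : x ∈ leaf (fun i => ⇑(φ i)) ν) (f g : C^∞⟮𝓡 m, M; 𝓘(ℝ, ℝ), ℝ⟯) (j : Fin k) :
    evalAt m x ((hZ j).toDerivation (hπ.toDerivation
      (quadraticCorrection (fun j => (hZ j).toDerivation) φ ν f)
      (quadraticCorrection (fun j => (hZ j).toDerivation) φ ν g))) = 0 := by
  obtain ⟨W, hWs, hW⟩ := hinv
  have hskew : ∀ F G, hπ.toDerivation F G = -hπ.toDerivation G F := fun F G => by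
    ext x
    exact hπ.skew F G F.contMDiff G.contMDiff x
  have h := derivation_bracket_quadraticCorrection_mem (Z := fun j => (hZ j).toDerivation) hskew
    (toDerivation_apply_eq hZ hZφ) hcomm (fun i j => ⇑(hWs i j).toDerivation) (fun i f g => by
      ext y
      refine (hW i f g f.contMDiff g.contMDiff y).trans ?_
      rw [apply_sum_wedge, ← evalAt_apply, map_sum]
      refine Finset.sum_congr rfl fun j _ => ?_
      rw [mul_comm (diff m f y _)]
      rw [map_sub, map_mul, map_mul, mul_comm (evalAt m y ((hWs i j).toDerivation g))]
      rfl) ν f g j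
  exact eq_zero_of_mem_leafIdeal h hx

theorem deformedBracket_jacobi {π : FiberOperator m M} (hπ : IsPoisson π)
    {φ : Fin k → C^∞⟮𝓡 m, M; 𝓘(ℝ, ℝ), ℝ⟯} {V Z : Fin k → VField m M}
    (hV : ∀ j, IsSmoothField (V j)) (hZ : ∀ j, IsSmoothField (Z j))
    (hZφ : ∀ i j x, lieDeriv (Z j) (φ i) x = if i = j then 1 else 0)
    (hinv : (∀ ν : Fin k → ℝ, OperatorInvariantOn π Z (leaf (fun i => ⇑(φ i)) ν)) ∨
      (IsInvolutive Z ∧ LieDerivInWedge π Z))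
    (D : C^∞⟮𝓡 m, M; 𝓘(ℝ, ℝ), ℝ⟯ →
      Derivation ℝ C^∞⟮𝓡 m, M; 𝓘(ℝ, ℝ), ℝ⟯ C^∞⟮𝓡 m, M; 𝓘(ℝ, ℝ), ℝ⟯)
    (hD : D = deformedBracket hπ.toDerivation (fun j => (hV j).toDerivation)
      (fun j => (hZ j).toDerivation))
    (hcas : ∀ F i, D F (φ i) = 0) (x : M) (F G H : C^∞⟮𝓡 m, M; 𝓘(ℝ, ℝ), ℝ⟯) :
    evalAt m x (D F (D G H) + D G (D H F) + D H (D F G)) = 0 := by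
  subst hD
  have hskew : ∀ F G, hπ.toDerivation F G = -hπ.toDerivation G F := fun F G => by
    ext x
    exact hπ.skew F G F.contMDiff G.contMDiff x
  have hjac : ∀ F G H, hπ.toDerivation F (hπ.toDerivation G H) +
      hπ.toDerivation G (hπ.toDerivation H F) + hπ.toDerivation H (hπ.toDerivation F G) = 0 :=
    fun F G H => by
      ext x
      exact hπ.jacobi F G H F.contMDiff G.contMDiff H.contMDiff x
  -- The leaf, and with it the correction, is chosen according to the point.
  obtain ⟨ν, hν⟩ : ∃ ν : Fin k → ℝ, ν = fun i => φ i x := ⟨_, rfl⟩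
  have hx : x ∈ leaf (fun i => ⇑(φ i)) ν := by
    rw [hν]
    exact fun i => rfl
  have hev : ∀ f ∈ leafIdeal φ ν, evalAt m x f = 0 :=
    fun f hf => eq_zero_of_mem_leafIdeal hf hx
  have hZφ' := toDerivation_apply_eq hZ hZφ
  rcases hinv with hA | ⟨hI, hW⟩
  · exact deformedBracket_jacobi_of_extension hskew hjac hcas (evalAt m x) hev
      (linearCorrection (fun j => (hZ j).toDerivation) φ ν)
      (linearCorrection_sub_mem _ φ ν)
      (derivation_linearCorrection_mem (Z := fun j => (hZ j).toDerivation) hZφ' ν)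
      (lieDeriv_bracket_linearCorrection hπ hZ hZφ (hA ν) hx) F G H
  · have hcomm : ∀ i j f, (hZ i).toDerivation ((hZ j).toDerivation f) =
        (hZ j).toDerivation ((hZ i).toDerivation f) := fun i j f => by
      ext y
      exact lieDeriv_comm_of_isInvolutive (fun i => (φ i).contMDiff) hZ hZφ hI f.contMDiff i j y
    exact deformedBracket_jacobi_of_extension hskew hjac hcas (evalAt m x) hev
      (quadraticCorrection (fun j => (hZ j).toDerivation) φ ν)
      (quadraticCorrection_sub_mem _ φ ν)
      (fun f j => Ideal.pow_le_self two_ne_zero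
        (derivation_quadraticCorrection_mem (Z := fun j => (hZ j).toDerivation) hZφ' hcomm ν f j))
      (lieDeriv_bracket_quadraticCorrection hπ hZ hZφ hcomm hW hx) F G H

theorem isPoisson_deformation {π : FiberOperator m M} (hπ : IsPoisson π) {φ : Fin k → M → ℝ}
    (hφ : ∀ i, IsSmooth m (φ i)) {Z V : Fin k → VField m M} (hZ : ∀ j, IsSmoothField (Z j))
    (hV : ∀ j, IsSmoothField (V j))
    (hZφ : ∀ i j x, lieDeriv (Z j) (φ i) x = if i = j then 1 else 0)
    (hinv : (∀ ν : Fin k → ℝ, OperatorInvariantOn π Z (leaf φ ν)) ∨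
      (IsInvolutive Z ∧ LieDerivInWedge π Z))
    (htan : ∀ (x : M) (α : TangentSpace (𝓡 m) x →L[ℝ] ℝ),
      deformation π V Z x α ∈ leafTangent φ x) :
    IsPoisson (deformation π V Z) := by
  let D := deformedBracket hπ.toDerivation (fun j => (hV j).toDerivation)
    (fun j => (hZ j).toDerivation)
  have hD : ∀ F G, ⇑(D F G) = bracket (deformation π V Z) F G := coe_deformedBracket hπ hV hZ
  let φ' : Fin k → C^∞⟮𝓡 m, M; 𝓘(ℝ, ℝ), ℝ⟯ := fun i => ⟨φ i, hφ i⟩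
  have hcas : ∀ F i, D F (φ' i) = 0 := fun F i => by
    ext x
    exact (congrFun (hD F (φ' i)) x).trans (isCasimir_deformation hπ hφ htan i F F.contMDiff x)
  refine ⟨fun F G hF hG => ?_, fun F G hF hG => bracket_deformation_skew hπ V Z hF hG,
    fun F G H hF hG hH x => ?_⟩
  · exact (congrArg (IsSmooth m) (hD ⟨F, hF⟩ ⟨G, hG⟩)).mp (D ⟨F, hF⟩ ⟨G, hG⟩).contMDiff
  · have hJ : ∀ F G H : C^∞⟮𝓡 m, M; 𝓘(ℝ, ℝ), ℝ⟯,
        bracket (deformation π V Z) F (bracket (deformation π V Z) G H) x +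
        bracket (deformation π V Z) G (bracket (deformation π V Z) H F) x +
        bracket (deformation π V Z) H (bracket (deformation π V Z) F G) x = 0 := fun F G H => by
      simp only [← hD]
      exact deformedBracket_jacobi (φ := φ') hπ hV hZ hZφ hinv D rfl hcas x F G H
    exact hJ ⟨F, hF⟩ ⟨G, hG⟩ ⟨H, hH⟩

end Deformation

/-! ### Restriction to a leaf and the reduced operator -/

section Reduction

variable {m k s : ℕ} {M : Type*} [TopologicalSpace M] [ChartedSpace (EuclideanSpace ℝ (Fin m)) M]
  {N : Type*} [TopologicalSpace N] [ChartedSpace (EuclideanSpace ℝ (Fin s)) N]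

/-- Smooth functions extend locally along an immersion. -/
theorem exists_isSmooth_comp_eventuallyEq [IsManifold (𝓡 m) ∞ M] [T2Space M] {ι : N → M} {y : N}
    (hι : Manifold.IsImmersionAt (𝓡 s) (𝓡 m) ∞ ι y) {f : N → ℝ} (hf : IsSmooth s f) :
    ∃ F : M → ℝ, IsSmooth m F ∧ F ∘ ι =ᶠ[𝓝 y] f := by
  let a := hι.domChart.extend (𝓡 s)
  let b := hι.codChart.extend (𝓡 m)
  -- In the normal form of an immersion, projecting to the first factor recovers the domain chart:
  -- `r ∘ ι = a` near `y`. The extension of `f` is `f ∘ a.symm ∘ r`.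
  let r : M → EuclideanSpace ℝ (Fin s) := fun z => (hι.equiv.symm (b z)).1
  have hb : ContMDiffOn (𝓡 m) (𝓡 m) ∞ b hι.codChart.source :=
    hι.codChart.contMDiffOn_extend hι.codChart_mem_maximalAtlas
  have hr : ContMDiffOn (𝓡 m) (𝓡 s) ∞ r hι.codChart.source :=
    (contDiff_fst.comp hι.equiv.symm.contDiff).contMDiff.comp_contMDiffOn hb
  have hU : IsOpen (hι.codChart.source ∩ r ⁻¹' a.target) :=
    hr.continuousOn.isOpen_inter_preimage hι.codChart.open_source
      hι.domChart.isOpen_extend_target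
  have ha : ContMDiffOn (𝓡 s) (𝓡 s) ∞ a.symm a.target := by
    have h := contMDiffOn_extend_symm (I := 𝓡 s) (n := ∞) hι.domChart_mem_maximalAtlas
    rwa [← hι.domChart.extend_target'] at h
  have hrι : ∀ z ∈ hι.domChart.source, r (ι z) = a z := fun z hz => by
    have hz' : z ∈ a.source := by rwa [hι.domChart.extend_source]
    have h := hι.writtenInCharts (a.map_source hz')
    simp only [Function.comp_apply] at h
    have h2 : b (ι z) = hι.equiv (a z, 0) := by
      rw [← h]
      exact congrArg (fun w => b (ι w)) (a.left_inv hz').symm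
    change (hι.equiv.symm (b (ι z))).1 = a z
    rw [h2, ContinuousLinearEquiv.symm_apply_apply]
  have hy := hι.mem_domChart_source
  have hyU : ι y ∈ hι.codChart.source ∩ r ⁻¹' a.target := by
    refine ⟨hι.mem_codChart_source, ?_⟩
    rw [mem_preimage, hrι y hy]
    exact a.map_source (by rwa [hι.domChart.extend_source])
  obtain ⟨F, hF, hFy⟩ := exists_isSmooth_eventuallyEq (g := fun z => f (a.symm (r z))) hU hyU
    (ContMDiff.comp_contMDiffOn hf (ha.comp (hr.mono inter_subset_left) fun z hz => hz.2))
  refine ⟨F, hF, ?_⟩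
  filter_upwards [hι.continuousAt.eventually hFy, hι.domChart.open_source.mem_nhds hy] with z hz hzs
  have hz' : z ∈ a.source := by rwa [hι.domChart.extend_source]
  rw [Function.comp_apply, hz, hrι z hzs, a.left_inv hz']

/-- Every function on `N` factors locally through `ι`, so by the chain rule all differentials kill
the kernel of `dι`, and differentials separate vectors. -/
theorem mfderiv_injective_of_isImmersionAt [IsManifold (𝓡 m) ∞ M] [T2Space M]
    [IsManifold (𝓡 s) ∞ N] [T2Space N] {ι : N → M} {y : N}
    (hι : Manifold.IsImmersionAt (𝓡 s) (𝓡 m) ∞ ι y) :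
    Function.Injective (mfderiv (𝓡 s) (𝓡 m) ι y) := by
  rw [injective_iff_map_eq_zero]
  intro v hv
  by_contra hne
  obtain ⟨α, hα⟩ : ∃ α : TangentSpace (𝓡 s) y →L[ℝ] ℝ, α v ≠ 0 := by
    have h := SeparatingDual.exists_ne_zero (R := ℝ) (V := EuclideanSpace ℝ (Fin s)) hne
    exact h
  obtain ⟨f, hf, rfl⟩ := exists_isSmooth_diff_eq y α
  obtain ⟨F, hF, hFf⟩ := exists_isSmooth_comp_eventuallyEq hι hf
  apply hα
  rw [← diff_congr hFf, diff_comp hF (hι.contMDiffAt.mdifferentiableAt (by simp)),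
    ContinuousLinearMap.comp_apply, hv, map_zero]

/-- The tangent map of a parametrization of a leaf is onto the tangent space of the leaf. -/
theorem range_mfderiv_eq_leafTangent {φ : Fin k → M → ℝ} (hφ : ∀ i, IsSmooth m (φ i))
    {Z : Fin k → VField m M}
    (hZφ : ∀ i j x, lieDeriv (Z j) (φ i) x = if i = j then 1 else 0) {ι : N → M} {y : N}
    (hι : MDifferentiableAt (𝓡 s) (𝓡 m) ι y) (hsk : s + k = m)
    (hinj : Function.Injective (mfderiv (𝓡 s) (𝓡 m) ι y)) {ν : Fin k → ℝ}
    (hrange : range ι ⊆ leaf φ ν) :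
    LinearMap.range (mfderiv (𝓡 s) (𝓡 m) ι y).toLinearMap = leafTangent φ (ι y) := by
  have : FiniteDimensional ℝ (TangentSpace (𝓡 m) (ι y)) :=
    inferInstanceAs (FiniteDimensional ℝ (EuclideanSpace ℝ (Fin m)))
  have hle : LinearMap.range (mfderiv (𝓡 s) (𝓡 m) ι y).toLinearMap ≤ leafTangent φ (ι y) := by
    rintro _ ⟨v, rfl⟩
    refine (Submodule.mem_iInf _).2 fun i => ?_
    have h := diff_comp (hφ i) hι
    have h2 : φ i ∘ ι = fun _ => ν i := funext fun z => hrange ⟨z, rfl⟩ i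
    rw [h2, diff_const] at h
    exact (DFunLike.congr_fun h v).symm
  let T : TangentSpace (𝓡 m) (ι y) →ₗ[ℝ] Fin k → ℝ :=
    LinearMap.pi fun i => (diff m (φ i) (ι y)).toLinearMap
  have hT : LinearMap.ker T = leafTangent φ (ι y) := LinearMap.ker_pi _
  have hTs : LinearMap.range T = ⊤ := by
    refine LinearMap.range_eq_top.2 fun c => ⟨∑ j, c j • Z j (ι y), ?_⟩
    funext i
    have h2 : ∀ a, diff m (φ i) (ι y) (c a • Z a (ι y)) = if i = a then c a else 0 := fun a => by
      rw [map_smul, smul_eq_mul]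
      exact (congrArg (c a * ·) (hZφ i a (ι y))).trans (by simp)
    change diff m (φ i) (ι y) _ = _
    rw [map_sum]
    simp [h2]
  -- The `dφᵢ` are jointly onto, so their common kernel has dimension `m - k = s`, the rank of the
  -- injective `dι`.
  refine Submodule.eq_of_le_of_finrank_eq hle ?_
  have h1 := LinearMap.finrank_range_add_finrank_ker T
  rw [hTs, hT, finrank_top, Module.finrank_fin_fun] at h1
  have h3 : Module.finrank ℝ (TangentSpace (𝓡 m) (ι y)) = m :=
    finrank_euclideanSpace_fin (𝕜 := ℝ) (n := m)
  have h4 : Module.finrank ℝ (TangentSpace (𝓡 s) y) = s :=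
    finrank_euclideanSpace_fin (𝕜 := ℝ) (n := s)
  rw [LinearMap.finrank_range_of_inj hinj, h4]
  omega

/-- The operator on `N` induced by an operator `π` on `M` and left inverses `L y` of the
differential of a map `ι : N → M`. -/
noncomputable def pullbackOperator (π : FiberOperator m M) (ι : N → M)
    (L : ∀ y, TangentSpace (𝓡 m) (ι y) →L[ℝ] TangentSpace (𝓡 s) y) : FiberOperator s N := fun y =>
  { toFun := fun β => L y (π (ι y) (β.comp (L y)))
    map_add' := fun α β => by rw [ContinuousLinearMap.add_comp, map_add, map_add]
    map_smul' := fun c β => by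
      rw [ContinuousLinearMap.smul_comp, map_smul, map_smul, RingHom.id_apply] }

/-- The covectors `α ∘ dι ∘ L` and `α` agree on the image of `dι`, where `π` takes its values; by
skewness `π` then kills their difference. Hence the choice of `L` is immaterial. -/
theorem mfderiv_pullbackOperator {π : FiberOperator m M} {ι : N → M}
    {L : ∀ y, TangentSpace (𝓡 m) (ι y) →L[ℝ] TangentSpace (𝓡 s) y} {y : N}
    (hL : ∀ v, L y (mfderiv (𝓡 s) (𝓡 m) ι y v) = v)
    (hskew : ∀ α β : TangentSpace (𝓡 m) (ι y) →L[ℝ] ℝ, α (π (ι y) β) = -β (π (ι y) α))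
    (htan : ∀ α, π (ι y) α ∈ LinearMap.range (mfderiv (𝓡 s) (𝓡 m) ι y).toLinearMap)
    (α : TangentSpace (𝓡 m) (ι y) →L[ℝ] ℝ) :
    mfderiv (𝓡 s) (𝓡 m) ι y
      (pullbackOperator π ι L y (α.comp (mfderiv (𝓡 s) (𝓡 m) ι y))) = π (ι y) α := by
  have hproj : ∀ β, mfderiv (𝓡 s) (𝓡 m) ι y (L y (π (ι y) β)) = π (ι y) β := fun β => by
    obtain ⟨v, hv⟩ := htan β
    rw [← hv]
    exact congrArg _ (hL v)
  refine (hproj _).trans ?_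
  rw [← sub_eq_zero, ← map_sub]
  set γ := (α.comp (mfderiv (𝓡 s) (𝓡 m) ι y)).comp (L y) - α with hγ
  have h0 : ∀ β : TangentSpace (𝓡 m) (ι y) →L[ℝ] ℝ, β (π (ι y) γ) = 0 := fun β => by
    rw [hskew, neg_eq_zero, hγ, sub_apply, ContinuousLinearMap.comp_apply,
      ContinuousLinearMap.comp_apply, hproj, sub_self]
  exact SeparatingDual.eq_zero_of_forall_dual_eq_zero (R := ℝ)
    (V := EuclideanSpace ℝ (Fin m)) h0

/-- The bracket of the induced operator is computed by local extensions. -/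
theorem bracket_eq_of_comp_eventuallyEq {π : FiberOperator m M} {πR : FiberOperator s N}
    {ι : N → M} (hι : MDifferentiable (𝓡 s) (𝓡 m) ι)
    (h : ∀ (y : N) (α : TangentSpace (𝓡 m) (ι y) →L[ℝ] ℝ),
      mfderiv (𝓡 s) (𝓡 m) ι y (πR y (α.comp (mfderiv (𝓡 s) (𝓡 m) ι y))) = π (ι y) α)
    {f g : N → ℝ} {F G : M → ℝ} (hF : IsSmooth m F) (hG : IsSmooth m G) {y : N}
    (hFf : F ∘ ι =ᶠ[𝓝 y] f) (hGg : G ∘ ι =ᶠ[𝓝 y] g) :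
    bracket πR f g y = bracket π F G (ι y) := by
  rw [bracket, ← diff_congr hFf, ← diff_congr hGg, diff_comp hF (hι y), diff_comp hG (hι y),
    ContinuousLinearMap.comp_apply, h]
  rfl

/-- Equality of germs makes a bracket of extensions an extension of the bracket, as the nested
brackets in the Jacobi identity require. -/
theorem bracket_comp_eventuallyEq {π : FiberOperator m M} {πR : FiberOperator s N}
    {ι : N → M} (hι : MDifferentiable (𝓡 s) (𝓡 m) ι)
    (h : ∀ (y : N) (α : TangentSpace (𝓡 m) (ι y) →L[ℝ] ℝ),
      mfderiv (𝓡 s) (𝓡 m) ι y (πR y (α.comp (mfderiv (𝓡 s) (𝓡 m) ι y))) = π (ι y) α)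
    {f g : N → ℝ} {F G : M → ℝ} (hF : IsSmooth m F) (hG : IsSmooth m G) {y : N}
    (hFf : F ∘ ι =ᶠ[𝓝 y] f) (hGg : G ∘ ι =ᶠ[𝓝 y] g) :
    bracket π F G ∘ ι =ᶠ[𝓝 y] bracket πR f g := by
  filter_upwards [hFf.eventuallyEq_nhds, hGg.eventuallyEq_nhds] with z hz hz'
  exact (bracket_eq_of_comp_eventuallyEq hι h hF hG hz hz').symm

/-- An operator on an immersed manifold to which a Poisson operator is related is Poisson. -/
theorem isPoisson_of_related [IsManifold (𝓡 m) ∞ M] [T2Space M] {π : FiberOperator m M}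
    (hπ : IsPoisson π) {πR : FiberOperator s N} {ι : N → M}
    (hι : Manifold.IsImmersion (𝓡 s) (𝓡 m) ∞ ι)
    (hιs : ContMDiff (𝓡 s) (𝓡 m) ∞ ι)
    (h : ∀ (y : N) (α : TangentSpace (𝓡 m) (ι y) →L[ℝ] ℝ),
      mfderiv (𝓡 s) (𝓡 m) ι y (πR y (α.comp (mfderiv (𝓡 s) (𝓡 m) ι y))) = π (ι y) α) :
    IsPoisson πR := by
  have hιd : MDifferentiable (𝓡 s) (𝓡 m) ι := hιs.mdifferentiable (by simp)
  have ext : ∀ (y : N) (f : N → ℝ), IsSmooth s f → ∃ F, IsSmooth m F ∧ F ∘ ι =ᶠ[𝓝 y] f :=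
    fun y f hf => exists_isSmooth_comp_eventuallyEq (hι.isImmersionAt y) hf
  refine ⟨fun f g hf hg y => ?_, fun f g hf hg y => ?_, fun f g e hf hg he y => ?_⟩
  · obtain ⟨F, hF, hFf⟩ := ext y f hf
    obtain ⟨G, hG, hGg⟩ := ext y g hg
    exact ((ContMDiff.comp (hπ.smooth F G hF hG) hιs) y).congr_of_eventuallyEq
      (bracket_comp_eventuallyEq hιd h hF hG hFf hGg).symm
  · obtain ⟨F, hF, hFf⟩ := ext y f hf
    obtain ⟨G, hG, hGg⟩ := ext y g hg
    rw [bracket_eq_of_comp_eventuallyEq hιd h hF hG hFf hGg,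
      bracket_eq_of_comp_eventuallyEq hιd h hG hF hGg hFf]
    exact hπ.skew F G hF hG _
  · obtain ⟨F, hF, hFf⟩ := ext y f hf
    obtain ⟨G, hG, hGg⟩ := ext y g hg
    obtain ⟨E, hE, hEe⟩ := ext y e he
    rw [bracket_eq_of_comp_eventuallyEq hιd h hF (hπ.smooth G E hG hE) hFf
        (bracket_comp_eventuallyEq hιd h hG hE hGg hEe),
      bracket_eq_of_comp_eventuallyEq hιd h hG (hπ.smooth E F hE hF) hGg
        (bracket_comp_eventuallyEq hιd h hE hF hEe hFf),
      bracket_eq_of_comp_eventuallyEq hιd h hE (hπ.smooth F G hF hG) hEe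
        (bracket_comp_eventuallyEq hιd h hF hG hFf hGg)]
    exact hπ.jacobi F G E hF hG hE _

variable [IsManifold (𝓡 m) ∞ M] [T2Space M]

theorem deformation_skew {π : FiberOperator m M} (hπ : IsPoisson π) (V Z : Fin k → VField m M)
    (x : M) (α β : TangentSpace (𝓡 m) x →L[ℝ] ℝ) :
    α (deformation π V Z x β) = -β (deformation π V Z x α) := by
  obtain ⟨F, hF, rfl⟩ := exists_isSmooth_diff_eq x α
  obtain ⟨G, hG, rfl⟩ := exists_isSmooth_diff_eq x β
  exact bracket_deformation_skew hπ V Z hF hG x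

-- Each correction term has a factor `dF(Zⱼ)` or `dG(Zⱼ)`. This is how `π_D`, restricted to the
-- leaf, computes the Marsden–Ratiu bracket.
omit [IsManifold (𝓡 m) ∞ M] [T2Space M] in
theorem bracket_deformation_of_isInvariantOn (π : FiberOperator m M) (V : Fin k → VField m M)
    {Z : Fin k → VField m M} {S : Set M} {F G : M → ℝ} (hF : IsInvariantOn Z S F)
    (hG : IsInvariantOn Z S G) {x : M} (hx : x ∈ S) :
    bracket (deformation π V Z) F G x = bracket π F G x := by
  have hF' : ∀ j, diff m F x (Z j x) = 0 := isInvariantOn_iff.1 hF x hx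
  have hG' : ∀ j, diff m G x (Z j x) = 0 := isInvariantOn_iff.1 hG x hx
  rw [bracket, apply_deformation, Finset.sum_eq_zero fun j _ => ?_, sub_zero]
  · rfl
  · rw [hF', hG', mul_zero, zero_mul, sub_zero]

/-- Every covector on an immersed leaf is the differential of the restriction of a smooth function
that is invariant on the leaf. -/
theorem exists_isInvariantOn_diff_comp_eq {φ : Fin k → M → ℝ} (hφ : ∀ i, IsSmooth m (φ i))
    {Z : Fin k → VField m M} (hZ : ∀ j, IsSmoothField (Z j))
    (hZφ : ∀ i j x, lieDeriv (Z j) (φ i) x = if i = j then 1 else 0) {ν : Fin k → ℝ}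
    {ι : N → M} (hrange : range ι ⊆ leaf φ ν) {y : N}
    (hι : MDifferentiableAt (𝓡 s) (𝓡 m) ι y)
    {L : TangentSpace (𝓡 m) (ι y) →L[ℝ] TangentSpace (𝓡 s) y}
    (hL : ∀ v, L (mfderiv (𝓡 s) (𝓡 m) ι y v) = v) (β : TangentSpace (𝓡 s) y →L[ℝ] ℝ) :
    ∃ F : M → ℝ, IsSmooth m F ∧ IsInvariantOn Z (range ι) F ∧ diff s (F ∘ ι) y = β := by
  obtain ⟨F, hF, hFβ⟩ := exists_isSmooth_diff_eq (ι y) (β.comp L)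
  let φ' : Fin k → C^∞⟮𝓡 m, M; 𝓘(ℝ, ℝ), ℝ⟯ := fun i => ⟨φ i, hφ i⟩
  let F' : C^∞⟮𝓡 m, M; 𝓘(ℝ, ℝ), ℝ⟯ := ⟨F, hF⟩
  let E := linearCorrection (fun j => (hZ j).toDerivation) φ' ν F'
  have hE : IsInvariantOn Z (range ι) E := isInvariantOn_iff.2 fun x hx j => by
    have h := derivation_linearCorrection_mem (φ := φ') (Z := fun j => (hZ j).toDerivation)
      (toDerivation_apply_eq hZ hZφ) ν F' j
    exact eq_zero_of_mem_leafIdeal h (hrange hx)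
  have hEF : ⇑E ∘ ι = F ∘ ι := funext fun z => by
    have h := eq_zero_of_mem_leafIdeal
      (linearCorrection_sub_mem (fun j => (hZ j).toDerivation) φ' ν F') (hrange ⟨z, rfl⟩)
    exact sub_eq_zero.1 h
  refine ⟨E, E.contMDiff, hE, ?_⟩
  rw [hEF, diff_comp hF hι, hFβ]
  ext v
  exact congrArg β (hL v)

theorem isReduction_of_related {π : FiberOperator m M} {V Z : Fin k → VField m M}
    (hD : IsPoisson (deformation π V Z)) {πR : FiberOperator s N} {ι : N → M}
    (hι : Manifold.IsImmersion (𝓡 s) (𝓡 m) ∞ ι) (hιs : ContMDiff (𝓡 s) (𝓡 m) ∞ ι)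
    (h : ∀ (y : N) (α : TangentSpace (𝓡 m) (ι y) →L[ℝ] ℝ),
      mfderiv (𝓡 s) (𝓡 m) ι y (πR y (α.comp (mfderiv (𝓡 s) (𝓡 m) ι y))) =
        deformation π V Z (ι y) α) :
    IsReduction π Z ι πR := by
  refine ⟨isPoisson_of_related hD hι hιs h, fun f g F G _ _ hF hG hFf hGg hFi hGi y => ?_⟩
  rw [bracket_eq_of_comp_eventuallyEq (hιs.mdifferentiable (by simp)) h hF hG
    (Filter.EventuallyEq.of_eq hFf) (Filter.EventuallyEq.of_eq hGg),
    bracket_deformation_of_isInvariantOn π V hFi hGi ⟨y, rfl⟩]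

/-- A fibrewise operator is determined by its values on pairs of covectors, and invariant functions
on `M` realize every such pair at `y`. -/
theorem IsReduction.unique {φ : Fin k → M → ℝ} (hφ : ∀ i, IsSmooth m (φ i))
    {Z : Fin k → VField m M} (hZ : ∀ j, IsSmoothField (Z j))
    (hZφ : ∀ i j x, lieDeriv (Z j) (φ i) x = if i = j then 1 else 0) {ν : Fin k → ℝ}
    {ι : N → M} (hrange : range ι ⊆ leaf φ ν) (hι : ContMDiff (𝓡 s) (𝓡 m) ∞ ι)
    {L : ∀ y, TangentSpace (𝓡 m) (ι y) →L[ℝ] TangentSpace (𝓡 s) y}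
    (hL : ∀ y v, L y (mfderiv (𝓡 s) (𝓡 m) ι y v) = v) {π : FiberOperator m M}
    {π₁ π₂ : FiberOperator s N} (h₁ : IsReduction π Z ι π₁) (h₂ : IsReduction π Z ι π₂) :
    π₁ = π₂ := by
  funext y
  refine LinearMap.ext fun β => ?_
  rw [← sub_eq_zero]
  have h0 : ∀ γ : TangentSpace (𝓡 s) y →L[ℝ] ℝ, γ (π₁ y β - π₂ y β) = 0 := fun γ => by
    have hd : MDifferentiableAt (𝓡 s) (𝓡 m) ι y := hι.mdifferentiable (by simp) y
    obtain ⟨F, hF, hFi, hFγ⟩ := exists_isInvariantOn_diff_comp_eq hφ hZ hZφ hrange hd (hL y) γ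
    obtain ⟨G, hG, hGi, hGβ⟩ := exists_isInvariantOn_diff_comp_eq hφ hZ hZφ hrange hd (hL y) β
    have e₁ := h₁.bracket_eq _ _ F G (ContMDiff.comp hF hι) (ContMDiff.comp hG hι) hF hG rfl rfl
      hFi hGi y
    have e₂ := h₂.bracket_eq _ _ F G (ContMDiff.comp hF hι) (ContMDiff.comp hG hι) hF hG rfl rfl
      hFi hGi y
    have e := e₁.trans e₂.symm
    rw [bracket, bracket, hFγ, hGβ] at e
    rw [map_sub, e, sub_self]
  exact SeparatingDual.eq_zero_of_forall_dual_eq_zero (R := ℝ)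
    (V := EuclideanSpace ℝ (Fin s)) h0

end Reduction

end DiracReduction

theorem mainTheorem1 {m k : ℕ} {M : Type u} [TopologicalSpace M]
    [ChartedSpace (EuclideanSpace ℝ (Fin m)) M] [IsManifold (𝓡 m) ∞ M]
    [T2Space M] [SecondCountableTopology M]
    (π : DiracReduction.FiberOperator m M) (hπ : DiracReduction.IsPoisson π)
    (φ : Fin k → M → ℝ) (hφ : ∀ i, DiracReduction.IsSmooth m (φ i))
    (Z V : Fin k → DiracReduction.VField m M)
    (hZ : ∀ j, DiracReduction.IsSmoothField (Z j))
    (hV : ∀ j, DiracReduction.IsSmoothField (V j))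
    (hZφ : ∀ i j x, DiracReduction.lieDeriv (Z j) (φ i) x = if i = j then 1 else 0)
    (hinv : (∀ ν : Fin k → ℝ, DiracReduction.OperatorInvariantOn π Z (DiracReduction.leaf φ ν)) ∨
      (DiracReduction.IsInvolutive Z ∧ DiracReduction.LieDerivInWedge π Z))
    (htan : ∀ (x : M) (α : TangentSpace (𝓡 m) x →L[ℝ] ℝ),
      DiracReduction.deformation π V Z x α ∈ DiracReduction.leafTangent φ x) :
    DiracReduction.IsPoisson (DiracReduction.deformation π V Z) ∧
    (∀ i, DiracReduction.IsCasimir (DiracReduction.deformation π V Z) (φ i)) ∧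
    (∀ (ν : Fin k → ℝ) (s : ℕ) (N : Type v) [TopologicalSpace N]
      [ChartedSpace (EuclideanSpace ℝ (Fin s)) N] [IsManifold (𝓡 s) ∞ N] (ι : N → M),
      s + k = m → Manifold.IsSmoothEmbedding (𝓡 s) (𝓡 m) ∞ ι →
      Set.range ι = DiracReduction.leaf φ ν →
      ∃ πR : DiracReduction.FiberOperator s N,
        DiracReduction.IsReduction π Z ι πR ∧
        (∀ πR' : DiracReduction.FiberOperator s N,
          DiracReduction.IsReduction π Z ι πR' → πR' = πR) ∧
        ∀ (y : N) (α : TangentSpace (𝓡 m) (ι y) →L[ℝ] ℝ),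
          DiracReduction.deformation π V Z (ι y) α =
            mfderiv (𝓡 s) (𝓡 m) ι y (πR y (α.comp (mfderiv (𝓡 s) (𝓡 m) ι y)))) := by
  have hD := DiracReduction.isPoisson_deformation hπ hφ hZ hV hZφ hinv htan
  refine ⟨hD, DiracReduction.isCasimir_deformation hπ hφ htan, ?_⟩
  intro ν s N _ _ _ ι hsk hι hrange
  have : T2Space N := hι.isEmbedding.t2Space
  have hιs : ContMDiff (𝓡 s) (𝓡 m) ∞ ι := hι.contMDiff
  have hιd : MDifferentiable (𝓡 s) (𝓡 m) ι := hιs.mdifferentiable (by simp)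
  have hinj : ∀ y, Function.Injective (mfderiv (𝓡 s) (𝓡 m) ι y) := fun y =>
    DiracReduction.mfderiv_injective_of_isImmersionAt (hι.isImmersion.isImmersionAt y)
  have hL : ∀ y, ∃ L : TangentSpace (𝓡 m) (ι y) →L[ℝ] TangentSpace (𝓡 s) y,
      ∀ v, L (mfderiv (𝓡 s) (𝓡 m) ι y v) = v := fun y => by
    have : FiniteDimensional ℝ (TangentSpace (𝓡 m) (ι y)) :=
      inferInstanceAs (FiniteDimensional ℝ (EuclideanSpace ℝ (Fin m)))
    have : T2Space (TangentSpace (𝓡 m) (ι y)) :=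
      inferInstanceAs (T2Space (EuclideanSpace ℝ (Fin m)))
    obtain ⟨L, hL⟩ := LinearMap.exists_leftInverse_of_injective
      (mfderiv (𝓡 s) (𝓡 m) ι y).toLinearMap (LinearMap.ker_eq_bot.2 (hinj y))
    exact ⟨LinearMap.toContinuousLinearMap L, fun v => LinearMap.congr_fun hL v⟩
  choose L hL using hL
  -- The left inverses `L y` are chosen pointwise, with no smoothness in `y`; smoothness of the
  -- reduced bracket comes from its relation to `π_D`.
  have h : ∀ (y : N) (α : TangentSpace (𝓡 m) (ι y) →L[ℝ] ℝ), mfderiv (𝓡 s) (𝓡 m) ι y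
      (DiracReduction.pullbackOperator (DiracReduction.deformation π V Z) ι L y
        (α.comp (mfderiv (𝓡 s) (𝓡 m) ι y))) = DiracReduction.deformation π V Z (ι y) α :=
    fun y => DiracReduction.mfderiv_pullbackOperator (hL y)
      (DiracReduction.deformation_skew hπ V Z (ι y)) fun α => by
        rw [DiracReduction.range_mfderiv_eq_leafTangent hφ hZφ (hιd y) hsk (hinj y) hrange.le]
        exact htan _ α
  have hR := DiracReduction.isReduction_of_related hD hι.isImmersion hιs h
  exact ⟨_, hR, fun πR' hR' => DiracReduction.IsReduction.unique hφ hZ hZφ hrange.le hιs hL hR' hR,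
    fun y α => (h y α).symm⟩
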